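/- Let $n\ge 1$ be an integer and $-\infty<a<b<\infty$. In $L^2(a,b)$ let $A=A_{\min}$ be the minimal operator generated by the expression $(-1)^n\frac{d^{2n}}{dx^{2n}}$, that is, $Af=(-1)^nf^{(2n)}$ on $$\operatorname{dom}A=\{f\in W^{2n,2}(a,b): f^{(k)}(a)=f^{(k)}(b)=0,\ 0\le k\le 2n-1\},$$ and let $A_{\max}f=(-1)^nf^{(2n)}$ on $\operatorname{dom}A_{\max}=W^{2n,2}(a,b)$. For $f\in W^{2n,2}(a,b)$ put $$\Gamma_0f=\bigl(f(a),\dots,f^{(n-1)}(a),f(b),\dots,f^{(n-1)}(b)\bigr)^{T}\in\mathbb C^{2n},$$ $$\Gamma_1f=\bigl((-1)^{n-1}f^{(2n-1)}(a),\dots,f^{(n)}(a),(-1)^{n}f^{(2n-1)}(b),\dots,-f^{(n)}(b)\bigr)^{T}\in\mathbb C^{2n}.$$ Then $A$ is densely defined, closed and symmetric, $A^*=A_{\max}$, and $\{\mathbb C^{2n},\Gamma_0,\Gamma_1\}$ is a boundary triplet for $A^*$: $(A^*f,g)-(f,A^*g)=(\Gamma_1f,\Gamma_0g)-(\Gamma_0f,\Gamma_1g)$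 for all $f,g\in\operatorname{dom}A^*$, and $f\mapsto(\Gamma_0f,\Gamma_1f)$ is onto $\mathbb C^{2n}\oplus\mathbb C^{2n}$. Let $A_0=A^*\!\upharpoonright\ker\Gamma_0$, and let $$M(z)=\Gamma_1\bigl(\Gamma_0\!\upharpoonright\ker(A^*-z)\bigr)^{-1},\qquad z\in\rho(A_0),$$ be the corresponding Weyl function. Define the $n\times n$ matrices (indices $i,j=0,\dots,n-1$) $$(T_1)_{ij}=\begin{cases}\frac{(b-a)^{i-j}}{(i-j)!},& i\ge j,\\ 0,& i<j,\end{cases}\qquad (T_2)_{ij}=\frac{(b-a)^{n+i-j}}{(n+i-j)!},$$ $$Q=\operatorname{diag}\bigl((-1)^n,(-1)^{n-1},\dots,-1\bigr),\qquad S_{ij}=\begin{cases}1,& i+j=n-1,\\0,&\text{otherwise.}\end{cases}$$ Then $T_2$ is invertible, a neighbourhood of $0$ is contained in $\rho(A_0)$, and with $$B_K=\begin{pmatrix} QT_2^{-1}T_1S & -QT_2^{-1}S\\ -QT_1T_2^{-1}T_1S & QT_1T_2^{-1}S\end{pmatrix}$$ one has $$B_K=M(0)=B_K^*.$$ Here $M(0)$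 is the limit of $M(z)$ at zero in each of the following senses: $M(z)\to B_K$ in norm as $z\to0$ in $\mathbb C$; the value of the Weyl function at the point $0\in\rho(A_0)$ equals $B_K$; and $B_K$ is the strong resolvent limit of $M(x)$ as $x\uparrow0$, i.e. $(M(x)-\zeta)^{-1}v\to(B_K-\zeta)^{-1}v$ for all $\zeta\in\mathbb C\setminus\mathbb R$ and $v\in\mathbb C^{2n}$. -/

import Mathlib

open MeasureTheory Set Filter Topology

namespace BoundaryTriplets

noncomputable section

/-! ### Abstract part: boundary triplets and Weyl functions -/

section Abstract

variable {H G : Type*} [NormedAddCommGroup H] [InnerProductSpace ℂ H]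
  [NormedAddCommGroup G] [InnerProductSpace ℂ G]

/-- `z` belongs to the resolvent set `ρ(S)` of an unbounded operator `S` iff `S - z` is a bijection
of `dom S` onto `H` with bounded inverse `R`. -/
def resolventSet (S : H →ₗ.[ℂ] H) : Set ℂ :=
  {z | ∃ R : H →L[ℂ] H,
    (∀ h : H, ∃ hR : R h ∈ S.domain, S ⟨R h, hR⟩ - z • R h = h) ∧
    ∀ f : S.domain, R (S f - z • (f : H)) = f}

/-- Restriction of an unbounded operator `T` to a subspace of its domain. -/
def restrictTo (T : H →ₗ.[ℂ] H) (V : Submodule ℂ T.domain) : H →ₗ.[ℂ] H :=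
  T.domRestrict (V.map T.domain.subtype)

/-- `{G, Γ₀, Γ₁}` is a boundary triplet for the adjoint `T = A†` of the densely defined closed
symmetric operator `A`. -/
structure IsBoundaryTriplet [CompleteSpace H] (A : H →ₗ.[ℂ] H) {T : H →ₗ.[ℂ] H}
    (Γ₀ Γ₁ : T.domain →ₗ[ℂ] G) : Prop where
  dense : Dense (A.domain : Set H)
  closed : A.IsClosed
  symmetric : A.IsFormalAdjoint A
  adjoint_eq : A.adjoint = T
  green : ∀ f g : T.domain,
    inner ℂ (g : H) (T f) - inner ℂ (T g) (f : H) =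
      inner ℂ (Γ₀ g) (Γ₁ f) - inner ℂ (Γ₁ g) (Γ₀ f)
  surjective : Function.Surjective (fun f : T.domain => (Γ₀ f, Γ₁ f))

/-- The defect subspace `N_z = ker (T - z)`, where `T` plays the role of the adjoint `A†`. -/
def defectSubspace (T : H →ₗ.[ℂ] H) (z : ℂ) : Submodule ℂ T.domain :=
  LinearMap.ker (T.toFun - z • T.domain.subtype)

/-- The `γ`-field `γ(z) = (Γ₀ restricted to N_z)⁻¹`. The restriction is bijective for all
`z ∈ ρ(A₀)`, see `bijective_restrict_defectSubspace`; elsewhere it may fail to be so, and then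
the value is set to `0`. -/
def gammaField {T : H →ₗ.[ℂ] H} (Γ₀ : T.domain →ₗ[ℂ] G) (z : ℂ) : G →ₗ[ℂ] T.domain :=
  open scoped Classical in
  if h : Function.Bijective (Γ₀.domRestrict (defectSubspace T z)) then
    (defectSubspace T z).subtype ∘ₗ (LinearEquiv.ofBijective _ h).symm.toLinearMap
  else 0

/-- The Weyl function `M(z) = Γ₁ γ(z)`. -/
def weylFunction [FiniteDimensional ℂ G] {T : H →ₗ.[ℂ] H} (Γ₀ Γ₁ : T.domain →ₗ[ℂ] G) (z : ℂ) :
    G →L[ℂ] G :=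
  LinearMap.toContinuousLinearMap (Γ₁ ∘ₗ gammaField Γ₀ z)

/-- For `z` in the resolvent set of `A₀ = T ↾ ker Γ₀`, the map `Γ₀ : N_z → G` is bijective. -/
theorem bijective_restrict_defectSubspace {T : H →ₗ.[ℂ] H} (Γ₀ : T.domain →ₗ[ℂ] G)
    (hΓ : Function.Surjective Γ₀) {z : ℂ}
    (hz : z ∈ resolventSet (restrictTo T (LinearMap.ker Γ₀))) :
    Function.Bijective (Γ₀.domRestrict (defectSubspace T z)) := by
  obtain ⟨R, h1, h2⟩ := hz
  constructor
  · rw [injective_iff_map_eq_zero]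
    rintro ⟨f, hf⟩ hf0
    have hf' : T f = z • (f : H) := by
      have := hf
      simp only [defectSubspace, LinearMap.mem_ker, LinearMap.sub_apply, LinearMap.smul_apply,
        Submodule.subtype_apply, sub_eq_zero] at this
      exact this
    have hk : f ∈ LinearMap.ker Γ₀ := hf0
    have hd : (f : H) ∈ (restrictTo T (LinearMap.ker Γ₀)).domain :=
      ⟨⟨f, hk, rfl⟩, f.2⟩
    have := h2 ⟨f, hd⟩
    have e : restrictTo T (LinearMap.ker Γ₀) ⟨f, hd⟩ = T f := rfl
    rw [e, hf'] at this
    simp only [sub_self, map_zero] at this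
    ext
    simpa using this.symm
  · intro y
    obtain ⟨f, rfl⟩ := hΓ y
    obtain ⟨hR, hR'⟩ := h1 (T f - z • (f : H))
    obtain ⟨⟨g, hg, hgR⟩, hgT⟩ := hR
    have e : restrictTo T (LinearMap.ker Γ₀) ⟨R (T f - z • (f : H)), ⟨⟨g, hg, hgR⟩, hgT⟩⟩ = T g :=
      LinearPMap.domRestrict_apply (by exact hgR.symm)
    rw [e, ← hgR] at hR'
    refine ⟨⟨f - g, ?_⟩, ?_⟩
    · change T (f - g) - z • ((f : H) - (g : H)) = 0
      rw [LinearPMap.map_sub, smul_sub, sub_sub_sub_comm, sub_eq_zero]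
      exact hR'.symm
    · have : Γ₀ g = 0 := hg
      simp [this]

/-- `B` is the strong resolvent limit of the operators `M x` as `x ↑ x₀`. -/
def IsStrongResolventLimitBelow [CompleteSpace G] (M : ℝ → G →L[ℂ] G) (x₀ : ℝ)
    (B : G →L[ℂ] G) : Prop :=
  ∀ ζ : ℂ, ζ.im ≠ 0 → ∀ v : G,
    Tendsto (fun x : ℝ => resolvent (M x) ζ v) (𝓝[<] x₀) (𝓝 (resolvent B ζ v))

end Abstract

/-! ### The Sobolev spaces `W^{m,2}(a,b)` and boundary values of derivatives -/

/-- The Hilbert space `L²(a,b)` of complex-valued functions. -/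
abbrev L2 (a b : ℝ) : Type := Lp ℂ 2 (volume.restrict (Ioo a b))

/-- `F 0, F 1, …, F m` are `f` and its derivatives up to order `m` on `[a,b]`: the function `F 0`
represents `f`, every `F k` with `k < m` is absolutely continuous on `[a,b]` with derivative
`F (k + 1)`, and `F m` is square integrable. -/
structure IsDerivChain (m : ℕ) (a b : ℝ) (f : L2 a b) (F : ℕ → ℝ → ℂ) : Prop where
  ae_eq : f =ᵐ[volume.restrict (Ioo a b)] F 0
  memLp : MemLp (F m) 2 (volume.restrict (Ioo a b))
  primitive : ∀ k < m, ∀ x ∈ Icc a b, F k x = F k a + ∫ t in a..x, F (k + 1) t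

namespace IsDerivChain

variable {m : ℕ} {a b : ℝ} {f g : L2 a b} {F F' : ℕ → ℝ → ℂ}

theorem intervalIntegrable_top (h : IsDerivChain m a b f F) (hab : a < b) :
    IntervalIntegrable (F m) volume a b := by
  rw [intervalIntegrable_iff_integrableOn_Ioo_of_le hab.le]
  exact h.memLp.integrable (by norm_num)

theorem continuousOn_of_intervalIntegrable (h : IsDerivChain m a b f F) (hab : a < b) {k : ℕ}
    (hk : k < m) (hi : IntervalIntegrable (F (k + 1)) volume a b) :
    ContinuousOn (F k) (Icc a b) := by
  have h1 := intervalIntegral.continuousOn_primitive_interval' hi left_mem_uIcc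
  rw [uIcc_of_le hab.le] at h1
  exact (continuousOn_const.add h1).congr (h.primitive k hk)

theorem intervalIntegrable (h : IsDerivChain m a b f F) (hab : a < b) :
    ∀ k ≤ m, IntervalIntegrable (F k) volume a b := by
  intro k hk
  induction hk using Nat.decreasingInduction with
  | self => exact h.intervalIntegrable_top hab
  | of_succ k hk ih =>
    have := h.continuousOn_of_intervalIntegrable hab hk ih
    rw [← uIcc_of_le hab.le] at this
    exact this.intervalIntegrable

theorem continuousOn (h : IsDerivChain m a b f F) (hab : a < b) {k : ℕ} (hk : k < m) :
    ContinuousOn (F k) (Icc a b) :=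
  h.continuousOn_of_intervalIntegrable hab hk (h.intervalIntegrable hab _ hk)

theorem add (h : IsDerivChain m a b f F) (h' : IsDerivChain m a b g F') (hab : a < b) :
    IsDerivChain m a b (f + g) (F + F') where
  ae_eq := by
    filter_upwards [Lp.coeFn_add f g, h.ae_eq, h'.ae_eq] with x h1 h2 h3
    rw [h1, Pi.add_apply, h2, h3]
    rfl
  memLp := h.memLp.add h'.memLp
  primitive k hk x hx := by
    have hs : uIcc a x ⊆ uIcc a b := by
      rw [uIcc_of_le hab.le, uIcc_of_le hx.1]; exact Icc_subset_Icc_right hx.2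
    simp only [Pi.add_apply]
    rw [h.primitive k hk x hx, h'.primitive k hk x hx, intervalIntegral.integral_add
      ((h.intervalIntegrable hab _ hk).mono_set hs) ((h'.intervalIntegrable hab _ hk).mono_set hs)]
    ring

theorem smul (h : IsDerivChain m a b f F) (c : ℂ) : IsDerivChain m a b (c • f) (c • F) where
  ae_eq := by
    filter_upwards [Lp.coeFn_smul c f, h.ae_eq] with x h1 h2
    rw [h1, Pi.smul_apply, h2]
    rfl
  memLp := h.memLp.const_smul c
  primitive k hk x hx := by
    simp only [Pi.smul_apply]
    rw [h.primitive k hk x hx, intervalIntegral.integral_smul, smul_add]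

theorem ae_eq_zero (h : IsDerivChain m a b 0 F) (hab : a < b) :
    ∀ k ≤ m, F k =ᵐ[volume.restrict (Ioo a b)] 0 := by
  intro k
  induction k with
  | zero =>
    intro _
    exact h.ae_eq.symm.trans (Lp.coeFn_zero _ _ _)
  | succ k ih =>
    intro hk
    have h0 := ih (by omega)
    have hc := h.continuousOn hab hk
    have hz : EqOn (F k) 0 (Ioo a b) := Measure.eqOn_open_of_ae_eq h0 isOpen_Ioo
      (hc.mono Ioo_subset_Icc_self) continuousOn_const
    have hd := (h.intervalIntegrable hab _ hk).ae_hasDerivAt_integral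
    refine (ae_restrict_iff' measurableSet_Ioo).2 ?_
    filter_upwards [hd] with x hx hxI
    have hx' := hx (by rw [uIcc_of_le hab.le]; exact Ioo_subset_Icc_self hxI) a left_mem_uIcc
    have he : (fun y => ∫ t in a..y, F (k + 1) t) =ᶠ[𝓝 x] fun _ => -F k a := by
      filter_upwards [Ioo_mem_nhds hxI.1 hxI.2] with y hy
      have h1 := h.primitive k hk y (Ioo_subset_Icc_self hy)
      rw [hz hy, Pi.zero_apply] at h1
      linear_combination -h1
    exact hx'.unique ((hasDerivAt_const x _).congr_of_eventuallyEq he)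

theorem eq_zero (h : IsDerivChain m a b 0 F) (hab : a < b) {k : ℕ} (hk : k < m) {x : ℝ}
    (hx : x ∈ Icc a b) : F k x = 0 := by
  have hz : EqOn (F k) 0 (Ioo a b) := Measure.eqOn_open_of_ae_eq (h.ae_eq_zero hab k hk.le)
    isOpen_Ioo ((h.continuousOn hab hk).mono Ioo_subset_Icc_self) continuousOn_const
  have := hz.of_subset_closure (h.continuousOn hab hk) continuousOn_const Ioo_subset_Icc_self
    (by rw [closure_Ioo hab.ne])
  exact this hx

theorem sub (h : IsDerivChain m a b f F) (h' : IsDerivChain m a b g F') (hab : a < b) :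
    IsDerivChain m a b (f - g) (F + (-1 : ℂ) • F') := by
  have := h.add (h'.smul (-1)) hab
  rwa [neg_one_smul, ← sub_eq_add_neg] at this

/-- The derivatives of order `k < m` are uniquely determined on `[a,b]`. -/
theorem unique (h : IsDerivChain m a b f F) (h' : IsDerivChain m a b f F') (hab : a < b) {k : ℕ}
    (hk : k < m) {x : ℝ} (hx : x ∈ Icc a b) : F k x = F' k x := by
  have h1 := h.sub h' hab
  rw [sub_self] at h1
  have := h1.eq_zero hab hk hx
  simpa [← sub_eq_add_neg, sub_eq_zero] using this

/-- The derivative of order `m` is uniquely determined almost everywhere. -/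
theorem unique_ae (h : IsDerivChain m a b f F) (h' : IsDerivChain m a b f F') (hab : a < b) :
    F m =ᵐ[volume.restrict (Ioo a b)] F' m := by
  have h1 := h.sub h' hab
  rw [sub_self] at h1
  filter_upwards [h1.ae_eq_zero hab m le_rfl] with x hx
  simpa [← sub_eq_add_neg, sub_eq_zero] using hx

theorem zero : IsDerivChain m a b 0 0 where
  ae_eq := Lp.coeFn_zero _ _ _
  memLp := MemLp.zero
  primitive k hk x hx := by simp

end IsDerivChain

/-- The Sobolev space `W^{m,2}(a,b)`, as a subspace of `L²(a,b)`. -/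
def sobolev (m : ℕ) {a b : ℝ} (hab : a < b) : Submodule ℂ (L2 a b) where
  carrier := {f | ∃ F, IsDerivChain m a b f F}
  add_mem' := fun ⟨_, hF⟩ ⟨_, hF'⟩ => ⟨_, hF.add hF' hab⟩
  zero_mem' := ⟨_, IsDerivChain.zero⟩
  smul_mem' := fun c _ ⟨_, hF⟩ => ⟨_, hF.smul c⟩

section Sobolev

variable {m : ℕ} {a b : ℝ}

/-- A choice of the derivatives `f, f', …, f^{(m)}` of `f ∈ W^{m,2}(a,b)`. -/
def derivChain {hab : a < b} (f : sobolev m hab) : ℕ → ℝ → ℂ := f.2.choose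

theorem isDerivChain_derivChain {hab : a < b} (f : sobolev m hab) :
    IsDerivChain m a b f (derivChain f) :=
  f.2.choose_spec

/-- The value `f^{(k)}(x)` of the `k`-th derivative, `k < m`, of `f ∈ W^{m,2}(a,b)` at a point
`x ∈ [a,b]`. -/
def derivAt (hab : a < b) (k : Fin m) (x : Icc a b) : sobolev m hab →ₗ[ℂ] ℂ where
  toFun f := derivChain f k x
  map_add' f g := (isDerivChain_derivChain (f + g)).unique
    ((isDerivChain_derivChain f).add (isDerivChain_derivChain g) hab) hab k.2 x.2
  map_smul' c f := (isDerivChain_derivChain (c • f)).unique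
    ((isDerivChain_derivChain f).smul c) hab k.2 x.2

/-- The derivative `f^{(m)} ∈ L²(a,b)` of highest order of `f ∈ W^{m,2}(a,b)`. -/
def topDeriv (hab : a < b) : sobolev m hab →ₗ[ℂ] L2 a b where
  toFun f := (isDerivChain_derivChain f).memLp.toLp _
  map_add' f g := by
    rw [← MemLp.toLp_add, MemLp.toLp_eq_toLp_iff]
    exact (isDerivChain_derivChain (f + g)).unique_ae
      ((isDerivChain_derivChain f).add (isDerivChain_derivChain g) hab) hab
  map_smul' c f := by
    rw [RingHom.id_apply, ← MemLp.toLp_const_smul, MemLp.toLp_eq_toLp_iff]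
    exact (isDerivChain_derivChain (c • f)).unique_ae
      ((isDerivChain_derivChain f).smul c) hab

end Sobolev

/-! ### The operator `(-1)ⁿ d²ⁿ/dx²ⁿ` on `(a,b)` -/

section Operator

variable (n : ℕ) {a b : ℝ} (hab : a < b)

/-- The maximal operator `A_max f = (-1)ⁿ f^{(2n)}`, `dom A_max = W^{2n,2}(a,b)`. -/
def maxOp : L2 a b →ₗ.[ℂ] L2 a b :=
  ⟨sobolev (2 * n) hab, (-1 : ℂ) ^ n • topDeriv hab⟩

/-- The minimal operator: the restriction of `A_max` to
`{f ∈ W^{2n,2}(a,b) : f^{(k)}(a) = f^{(k)}(b) = 0, k = 0, …, 2n - 1}`. -/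
def minOp : L2 a b →ₗ.[ℂ] L2 a b :=
  restrictTo (maxOp n hab)
    (⨅ k : Fin (2 * n), LinearMap.ker (derivAt hab k ⟨a, left_mem_Icc.2 hab.le⟩) ⊓
      LinearMap.ker (derivAt hab k ⟨b, right_mem_Icc.2 hab.le⟩))

/-- The boundary space `ℂ^{2n} = ℂⁿ ⊕ ℂⁿ` with its Euclidean inner product. -/
abbrev BoundarySpace : Type := EuclideanSpace ℂ (Fin n ⊕ Fin n)

/-- `Γ₀ f = (f(a), …, f^{(n-1)}(a), f(b), …, f^{(n-1)}(b))`. -/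
def Gamma0 : (maxOp n hab).domain →ₗ[ℂ] BoundarySpace n :=
  (WithLp.linearEquiv 2 ℂ (Fin n ⊕ Fin n → ℂ)).symm.toLinearMap ∘ₗ
    LinearMap.pi (Sum.elim
      (fun i : Fin n => derivAt (m := 2 * n) hab ⟨i, by omega⟩ ⟨a, left_mem_Icc.2 hab.le⟩)
      (fun i : Fin n => derivAt (m := 2 * n) hab ⟨i, by omega⟩ ⟨b, right_mem_Icc.2 hab.le⟩))

/-- `Γ₁ f = ((-1)^{n-1} f^{(2n-1)}(a), …, f^{(n)}(a), (-1)ⁿ f^{(2n-1)}(b), …, -f^{(n)}(b))`. -/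
def Gamma1 : (maxOp n hab).domain →ₗ[ℂ] BoundarySpace n :=
  (WithLp.linearEquiv 2 ℂ (Fin n ⊕ Fin n → ℂ)).symm.toLinearMap ∘ₗ
    LinearMap.pi (Sum.elim
      (fun i : Fin n => (-1 : ℂ) ^ (n - 1 - i.1) •
        derivAt (m := 2 * n) hab ⟨2 * n - 1 - i, by omega⟩ ⟨a, left_mem_Icc.2 hab.le⟩)
      (fun i : Fin n => (-1 : ℂ) ^ (n - i.1) •
        derivAt (m := 2 * n) hab ⟨2 * n - 1 - i, by omega⟩ ⟨b, right_mem_Icc.2 hab.le⟩))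

/-- The operator `A₀ = A_max ↾ ker Γ₀`. -/
def dirichletOp : L2 a b →ₗ.[ℂ] L2 a b :=
  restrictTo (maxOp n hab) (LinearMap.ker (Gamma0 n hab))

end Operator

/-! ### The matrix `B_K` -/

section Matrices

variable (n : ℕ) (a b : ℝ)

/-- `T₁ = ((b-a)^{i-j} / (i-j)!)` for `i ≥ j`, and `0` above the diagonal. -/
def matT1 : Matrix (Fin n) (Fin n) ℂ :=
  Matrix.of fun i j => if j ≤ i then ((b - a : ℝ) : ℂ) ^ (i.1 - j.1) / (i.1 - j.1).factorial else 0

/-- `T₂ = ((b-a)^{n+i-j} / (n+i-j)!)`. -/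
def matT2 : Matrix (Fin n) (Fin n) ℂ :=
  Matrix.of fun i j => ((b - a : ℝ) : ℂ) ^ (n + i.1 - j.1) / (n + i.1 - j.1).factorial

/-- `Q = diag((-1)ⁿ, (-1)^{n-1}, …, -1)`. -/
def matQ : Matrix (Fin n) (Fin n) ℂ :=
  Matrix.diagonal fun i => (-1) ^ (n - i.1)

/-- `S` has ones on the antidiagonal and zeros elsewhere. -/
def matS : Matrix (Fin n) (Fin n) ℂ :=
  Matrix.of fun i j => if i.1 + j.1 + 1 = n then 1 else 0

/-- The block matrix `B_K`. -/
def matBK : Matrix (Fin n ⊕ Fin n) (Fin n ⊕ Fin n) ℂ :=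
  Matrix.fromBlocks
    (matQ n * (matT2 n a b)⁻¹ * matT1 n a b * matS n)
    (-(matQ n * (matT2 n a b)⁻¹ * matS n))
    (-(matQ n * matT1 n a b * (matT2 n a b)⁻¹ * matT1 n a b * matS n))
    (matQ n * matT1 n a b * (matT2 n a b)⁻¹ * matS n)

end Matrices

end

end BoundaryTriplets

/-!
Everything follows from three facts about `T = A_max`: Green's identity for `Γ₀` and `Γ₁`,
surjectivity of `T`, and the fact that every vector of `ℂ²ⁿ` is `Γ₀ k` for some `k ∈ ker T`
(`IsInvertibleGreenPair`).

The abstract part derives the operator theory from them. Subtracting an element of `ker T` shows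
that `A₀ = T ↾ ker Γ₀` is onto; by Green's identity it is symmetric, so it is injective, and its
inverse `R` is everywhere defined and symmetric, hence bounded (`exists_inverse`). Thus `1 - z R` is
invertible for small `z`, which gives a neighbourhood of `0` in the resolvent set and the formula
`M(z) = M(0) + z γ(0)* (1 - z R)⁻¹ γ(0)`, so `M` is continuous at `0`
(`continuousAt_weylFunction_zero`). Green's identity on `ker T` says that `M(0)` is self-adjoint, and
norm convergence to a self-adjoint limit implies convergence of the resolvents. Green's identity also
shows that the range of the minimal operator is the orthogonal complement of the finite-dimensional
space `ker T`. From this one reads off that the minimal operator is densely defined and closed, that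
its adjoint is `T`, and that `(Γ₀, Γ₁)` is onto (`isBoundaryTriplet`).

For the differential expression, Green's identity is repeated integration by parts; the highest
derivative is only square integrable, so the version for absolutely continuous functions is needed
(`integral_mul_add_integral_mul_of_primitive`). Surjectivity of `T` is iterated integration. The
elements of `ker T` are the polynomials of degree `< 2n`. With `u`, `w` the derivatives of order `< n`
at `a` and `b`, and `v` the derivatives of order `≥ n` at `a` in decreasing order, Taylor's formula
reads `T₂ v + T₁ S u = S w`, and the derivatives of order `≥ n` at `b` in decreasing order are `T₁ v`
(`matT1_mulVec`, `matT2_mulVec_add`). The matrix `T₂` is injective, because a polynomial of degree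
`< 2n` with `u = w = 0` vanishes by the energy identity. Solving for `v` gives both the third fact and
`Γ₁ = B_K Γ₀` on `ker T`, that is, `M(0) = B_K`.
-/

namespace BoundaryTriplets

/-! ### Boundary maps for which the reference extension is invertible -/

section AbstractTriplet

variable {H G : Type*} [NormedAddCommGroup H] [InnerProductSpace ℂ H]
  [NormedAddCommGroup G] [InnerProductSpace ℂ G]

theorem mem_domain_restrictTo {T : H →ₗ.[ℂ] H} {V : Submodule ℂ T.domain} {x : H} :
    x ∈ (restrictTo T V).domain ↔ ∃ f ∈ V, (f : H) = x := by
  constructor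
  · rintro ⟨⟨f, hf, hfx⟩, -⟩
    exact ⟨f, hf, hfx⟩
  · rintro ⟨f, hf, rfl⟩
    exact ⟨⟨f, hf, rfl⟩, f.2⟩

theorem restrictTo_apply {T : H →ₗ.[ℂ] H} {V : Submodule ℂ T.domain}
    (x : (restrictTo T V).domain) (f : T.domain) (h : (f : H) = x) :
    restrictTo T V x = T f :=
  LinearPMap.domRestrict_apply h.symm

theorem mem_defectSubspace {T : H →ₗ.[ℂ] H} {z : ℂ} {f : T.domain} :
    f ∈ defectSubspace T z ↔ T f = z • (f : H) := by
  change T f - z • (f : H) = 0 ↔ _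
  rw [sub_eq_zero]

/-- The `γ`-field is computed by exhibiting an element of the defect subspace with the required
boundary value. -/
theorem gammaField_eq {T : H →ₗ.[ℂ] H} {Γ₀ : T.domain →ₗ[ℂ] G} {z : ℂ}
    (hb : Function.Bijective (Γ₀.domRestrict (defectSubspace T z)))
    {k : T.domain} (hk : T k = z • (k : H)) : gammaField Γ₀ z (Γ₀ k) = k := by
  have h : (LinearEquiv.ofBijective _ hb).symm (Γ₀ k) = ⟨k, mem_defectSubspace.2 hk⟩ := by
    rw [LinearEquiv.symm_apply_eq]
    rfl
  rw [gammaField, dif_pos hb]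
  simp [h]

/-- Green's identity for `T` and the boundary maps `Γ₀`, `Γ₁`, together with the two properties
that make the extension `T ↾ ker Γ₀` invertible: `T` is onto, and every boundary value is the
`Γ₀`-value of an element of `ker T`. -/
structure IsInvertibleGreenPair (T : H →ₗ.[ℂ] H) (Γ₀ Γ₁ : T.domain →ₗ[ℂ] G) : Prop where
  green : ∀ f g : T.domain,
    inner ℂ (g : H) (T f) - inner ℂ (T g) (f : H) =
      inner ℂ (Γ₀ g) (Γ₁ f) - inner ℂ (Γ₁ g) (Γ₀ f)
  surjective : ∀ h : H, ∃ f : T.domain, T f = h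
  exists_ker : ∀ y : G, ∃ k : T.domain, T k = 0 ∧ Γ₀ k = y

namespace IsInvertibleGreenPair

variable {T : H →ₗ.[ℂ] H} {Γ₀ Γ₁ : T.domain →ₗ[ℂ] G}

theorem exists_apply_eq (hP : IsInvertibleGreenPair T Γ₀ Γ₁) (h : H) :
    ∃ f : T.domain, T f = h ∧ Γ₀ f = 0 := by
  obtain ⟨f, hf⟩ := hP.surjective h
  obtain ⟨k, hk, hk'⟩ := hP.exists_ker (Γ₀ f)
  exact ⟨f - k, by rw [LinearPMap.map_sub, hf, hk, sub_zero], by rw [map_sub, hk', sub_self]⟩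

theorem inner_comm (hP : IsInvertibleGreenPair T Γ₀ Γ₁) {f g : T.domain} (hf : Γ₀ f = 0)
    (hg : Γ₀ g = 0) : inner ℂ (g : H) (T f) = inner ℂ (T g) (f : H) := by
  have := hP.green f g
  rwa [hf, hg, inner_zero_left, inner_zero_right, sub_zero, sub_eq_zero] at this

theorem eq_zero (hP : IsInvertibleGreenPair T Γ₀ Γ₁) {f : T.domain} (hf : T f = 0)
    (hf' : Γ₀ f = 0) : f = 0 := by
  obtain ⟨g, hg, hg'⟩ := hP.exists_apply_eq (f : H)
  have := hP.inner_comm hf' hg'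
  rw [hf, hg, inner_zero_right] at this
  exact Subtype.ext (inner_self_eq_zero.1 this.symm)

/-- The inverse of `T ↾ ker Γ₀` is everywhere defined and symmetric, hence bounded by the
Hellinger–Toeplitz theorem. -/
theorem exists_inverse [CompleteSpace H] (hP : IsInvertibleGreenPair T Γ₀ Γ₁) :
    ∃ R : H →L[ℂ] H, (∀ h, ∃ f : T.domain, (f : H) = R h ∧ T f = h ∧ Γ₀ f = 0) ∧
      ∀ f : T.domain, Γ₀ f = 0 → R (T f) = f := by
  choose r hr hr' using hP.exists_apply_eq
  have huniq : ∀ f g : T.domain, T f = T g → Γ₀ f = Γ₀ g → f = g := fun f g h h' =>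
    sub_eq_zero.1 (hP.eq_zero (by rw [LinearPMap.map_sub, h, sub_self])
      (by rw [map_sub, h', sub_self]))
  let L : H →ₗ[ℂ] H :=
    { toFun := fun h => r h
      map_add' := fun x y => by
        rw [huniq (r (x + y)) (r x + r y) (by rw [LinearPMap.map_add, hr, hr, hr])
          (by simp [hr'])]
        rfl
      map_smul' := fun c x => by
        rw [huniq (r (c • x)) (c • r x) (by rw [LinearPMap.map_smul, hr, hr])
          (by simp [hr'])]
        rfl }
  have hL : L.IsSymmetric := fun x y => by
    change inner ℂ (r x : H) y = inner ℂ x (r y : H)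
    have := hP.inner_comm (hr' y) (hr' x)
    rwa [hr, hr] at this
  refine ⟨⟨L, hL.continuous⟩, fun h => ⟨r h, rfl, hr h, hr' h⟩, fun f hf => ?_⟩
  change ((r (T f) : T.domain) : H) = f
  rw [huniq (r (T f)) f (hr _) (by rw [hr', hf])]

/-- If `1 - z R` is invertible, where `R` is the inverse of `A₀ = T ↾ ker Γ₀`, then `z` belongs to
the resolvent set of `A₀`, with resolvent `R (1 - z R)⁻¹`. -/
theorem mem_resolventSet_of_isUnit {R : H →L[ℂ] H}
    (hR : ∀ h, ∃ f : T.domain, (f : H) = R h ∧ T f = h ∧ Γ₀ f = 0)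
    (hR' : ∀ f : T.domain, Γ₀ f = 0 → R (T f) = f) {z : ℂ} (hz : IsUnit (1 - z • R)) :
    z ∈ resolventSet (restrictTo T (LinearMap.ker Γ₀)) := by
  have hc : Commute R (Ring.inverse (1 - z • R)) := by
    have h : Commute R (1 - z • R) :=
      (Commute.one_right R).sub_right ((Commute.refl R).smul_right z)
    obtain ⟨u, hu⟩ := hz
    rw [← hu] at h ⊢
    rw [Ring.inverse_unit]
    exact h.units_inv_right
  refine ⟨R * Ring.inverse (1 - z • R), fun h => ?_, fun f => ?_⟩
  · obtain ⟨f, hf, hTf, hf0⟩ := hR (Ring.inverse (1 - z • R) h)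
    have hd := mem_domain_restrictTo.2 ⟨f, LinearMap.mem_ker.2 hf0, hf⟩
    refine ⟨hd, ?_⟩
    rw [restrictTo_apply _ f hf, hTf]
    have := congrArg (fun B : H →L[ℂ] H => B h) (Ring.mul_inverse_cancel _ hz)
    simpa using this
  · obtain ⟨g, hg, hgf⟩ := mem_domain_restrictTo.1 f.2
    rw [restrictTo_apply _ g hgf, hc.eq, ← hgf]
    have h1 := congrArg (fun B : H →L[ℂ] H => B (g : H)) (Ring.inverse_mul_cancel _ hz)
    have h2 : R (T g - z • (g : H)) = (1 - z • R) (g : H) := by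
      simp [hR' g hg]
    rw [mul_apply_eq_comp, h2]
    simpa using h1

theorem eventually_isUnit_one_sub_smul [CompleteSpace H] (R : H →L[ℂ] H) :
    ∀ᶠ z : ℂ in 𝓝 0, IsUnit (1 - z • R) := by
  have hc : ContinuousAt (fun z : ℂ => 1 - z • R) 0 := by fun_prop
  refine hc.eventually_mem (Units.isOpen.mem_nhds ?_)
  simp

theorem resolventSet_mem_nhds [CompleteSpace H] (hP : IsInvertibleGreenPair T Γ₀ Γ₁) :
    resolventSet (restrictTo T (LinearMap.ker Γ₀)) ∈ 𝓝 (0 : ℂ) := by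
  obtain ⟨R, hR, hR'⟩ := hP.exists_inverse
  filter_upwards [eventually_isUnit_one_sub_smul R] with z hz
  exact mem_resolventSet_of_isUnit hR hR' hz

theorem bijective_zero [CompleteSpace H] (hP : IsInvertibleGreenPair T Γ₀ Γ₁) :
    Function.Bijective (Γ₀.domRestrict (defectSubspace T 0)) :=
  bijective_restrict_defectSubspace Γ₀ (fun y => (hP.exists_ker y).imp fun _ h => h.2)
    (mem_of_mem_nhds hP.resolventSet_mem_nhds)

theorem gammaField_zero [CompleteSpace H] (hP : IsInvertibleGreenPair T Γ₀ Γ₁) (y : G) :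
    T (gammaField Γ₀ 0 y) = 0 ∧ Γ₀ (gammaField Γ₀ 0 y) = y := by
  obtain ⟨k, hk, rfl⟩ := hP.exists_ker y
  rw [gammaField_eq hP.bijective_zero (by rw [hk, zero_smul])]
  exact ⟨hk, rfl⟩

/-- If `Γ₀ f = 0` and `T f` is orthogonal to `ker T`, then also `Γ₁ f = 0`. Hence `T` maps
`ker Γ₀ ∩ ker Γ₁` onto the orthogonal complement of `ker T`. -/
theorem gamma1_eq_zero_of_orthogonal (hP : IsInvertibleGreenPair T Γ₀ Γ₁) {f : T.domain}
    (hf : Γ₀ f = 0) (h : ∀ k : T.domain, T k = 0 → inner ℂ (k : H) (T f) = 0) : Γ₁ f = 0 := by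
  refine ext_inner_left ℂ fun y => ?_
  obtain ⟨k, hk, rfl⟩ := hP.exists_ker y
  have := hP.green f k
  rw [hk, hf, inner_zero_left, inner_zero_right, sub_zero, sub_zero, h k hk] at this
  rw [← this, inner_zero_right]

variable [FiniteDimensional ℂ G]

/-- The value at `0` of the Weyl function is read off from the boundary values of `ker T`. -/
theorem weylFunction_zero [CompleteSpace H] (hP : IsInvertibleGreenPair T Γ₀ Γ₁) {k : T.domain}
    (hk : T k = 0) : weylFunction Γ₀ Γ₁ 0 (Γ₀ k) = Γ₁ k := by
  change Γ₁ (gammaField Γ₀ 0 (Γ₀ k)) = _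
  rw [gammaField_eq hP.bijective_zero (by rw [hk, zero_smul])]

theorem isSelfAdjoint_weylFunction_zero [CompleteSpace H] [CompleteSpace G]
    (hP : IsInvertibleGreenPair T Γ₀ Γ₁) : IsSelfAdjoint (weylFunction Γ₀ Γ₁ 0) := by
  rw [ContinuousLinearMap.isSelfAdjoint_iff_isSymmetric]
  intro x y
  obtain ⟨f, hf, rfl⟩ := hP.exists_ker x
  obtain ⟨g, hg, rfl⟩ := hP.exists_ker y
  have := hP.green g f
  rw [hf, hg, inner_zero_left, inner_zero_right, sub_zero, eq_comm, sub_eq_zero] at this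
  simpa [hP.weylFunction_zero hf, hP.weylFunction_zero hg] using this.symm

/-- The Weyl function satisfies `M(z) = M(0) + z γ(0)* (1 - z A₀⁻¹)⁻¹ γ(0)` near `0`, which makes it
continuous there. -/
theorem continuousAt_weylFunction_zero [CompleteSpace H]
    (hP : IsInvertibleGreenPair T Γ₀ Γ₁) : ContinuousAt (weylFunction Γ₀ Γ₁) 0 := by
  have : CompleteSpace G := FiniteDimensional.complete ℂ G
  obtain ⟨R, hR, hR'⟩ := hP.exists_inverse
  let C : G →L[ℂ] H :=
    LinearMap.toContinuousLinearMap (T.domain.subtype ∘ₗ gammaField Γ₀ 0)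
  have hC : ∀ y, C y = gammaField Γ₀ 0 y := fun y => rfl
  -- Green's identity for `f ∈ ker Γ₀` and `γ(0) y` gives `Γ₁ f = γ(0)* T f`.
  have hadj : ∀ f : T.domain, Γ₀ f = 0 → Γ₁ f = C.adjoint (T f) := by
    intro f hf
    refine ext_inner_left ℂ fun y => ?_
    have := hP.green f (gammaField Γ₀ 0 y)
    rw [(hP.gammaField_zero y).1, (hP.gammaField_zero y).2, hf, inner_zero_left,
      inner_zero_right, sub_zero, sub_zero] at this
    rw [ContinuousLinearMap.adjoint_inner_right, hC, this]
  have hM : ∀ z : ℂ, IsUnit (1 - z • R) → weylFunction Γ₀ Γ₁ z =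
      weylFunction Γ₀ Γ₁ 0 + z • (C.adjoint ∘L Ring.inverse (1 - z • R) ∘L C) := by
    intro z hz
    ext1 y
    obtain ⟨f, hf, hTf, hf0⟩ := hR (Ring.inverse (1 - z • R) (C y))
    have hU := congrArg (fun B : H →L[ℂ] H => B (C y)) (Ring.mul_inverse_cancel _ hz)
    obtain ⟨hk1, hk2⟩ := hP.gammaField_zero y
    have hΓ : Γ₀ (gammaField Γ₀ 0 y + z • f) = y := by simp [hf0, hk2]
    have hT : T (gammaField Γ₀ 0 y + z • f) =
        z • ((gammaField Γ₀ 0 y + z • f : T.domain) : H) := by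
      rw [LinearPMap.map_add, LinearPMap.map_smul, hk1, hTf, zero_add]
      congr 1
      have h2 : Ring.inverse (1 - z • R) (C y) - z • R (Ring.inverse (1 - z • R) (C y)) = C y := by
        simpa using hU
      rw [← hf] at h2
      rw [sub_eq_iff_eq_add.1 h2, hC]
      rfl
    have hb := bijective_restrict_defectSubspace Γ₀
      (fun y => (hP.exists_ker y).imp fun _ h => h.2) (mem_resolventSet_of_isUnit hR hR' hz)
    have hγ := gammaField_eq hb hT
    rw [hΓ] at hγ
    change Γ₁ (gammaField Γ₀ z y) = Γ₁ (gammaField Γ₀ 0 y) + z • C.adjoint _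
    rw [hγ, map_add, map_smul, hadj f hf0, hTf]
    rfl
  have hinv : ContinuousAt (fun z : ℂ => Ring.inverse (1 - z • R)) 0 := by
    refine ContinuousAt.comp (g := Ring.inverse) (f := fun z : ℂ => 1 - z • R) ?_ (by fun_prop)
    simpa using NormedRing.inverse_continuousAt (1 : (H →L[ℂ] H)ˣ)
  have hcont : ContinuousAt (fun z : ℂ => weylFunction Γ₀ Γ₁ 0 +
      z • (C.adjoint ∘L Ring.inverse (1 - z • R) ∘L C)) 0 :=
    continuousAt_const.add (continuousAt_id.smul
      (continuousAt_const.clm_comp (hinv.clm_comp continuousAt_const)))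
  exact hcont.congr ((eventually_isUnit_one_sub_smul R).mono fun z hz => (hM z hz).symm)

/-- The orthogonal complement of `T (ker Γ₀ ∩ ker Γ₁)` is `ker T`, which is closed because it is
finite-dimensional. -/
theorem mem_ker_of_orthogonal [CompleteSpace H] (hP : IsInvertibleGreenPair T Γ₀ Γ₁) {h : H}
    (hh : ∀ f : T.domain, Γ₀ f = 0 → Γ₁ f = 0 → inner ℂ h (T f) = 0) :
    ∃ k : T.domain, (k : H) = h ∧ T k = 0 := by
  let K : Submodule ℂ H := LinearMap.range (T.domain.subtype ∘ₗ gammaField Γ₀ 0)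
  have hK : ∀ k : T.domain, T k = 0 → (k : H) ∈ K := fun k hk =>
    ⟨Γ₀ k, congrArg Subtype.val
      (gammaField_eq hP.bijective_zero (by rw [hk, zero_smul]))⟩
  have hm : h ∈ Kᗮᗮ := by
    rw [Submodule.mem_orthogonal]
    intro u hu
    obtain ⟨f, rfl, hf0⟩ := hP.exists_apply_eq u
    have hf1 := hP.gamma1_eq_zero_of_orthogonal hf0 fun k hk =>
      Submodule.inner_right_of_mem_orthogonal (hK k hk) hu
    exact inner_eq_zero_symm.1 (hh f hf0 hf1)
  rw [Submodule.orthogonal_orthogonal] at hm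
  obtain ⟨y, rfl⟩ := hm
  exact ⟨_, rfl, (hP.gammaField_zero y).1⟩

/-- The restriction of `T` to `ker Γ₀ ∩ ker Γ₁` has `T` as its adjoint, with `(Γ₀, Γ₁)` as boundary
maps of a boundary triplet. -/
theorem isBoundaryTriplet [CompleteSpace H] (hP : IsInvertibleGreenPair T Γ₀ Γ₁)
    {V : Submodule ℂ T.domain} (hV : ∀ f, f ∈ V ↔ Γ₀ f = 0 ∧ Γ₁ f = 0) :
    IsBoundaryTriplet (restrictTo T V) Γ₀ Γ₁ := by
  have hform : T.IsFormalAdjoint (restrictTo T V) := by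
    intro g f
    obtain ⟨f', hf', hff'⟩ := mem_domain_restrictTo.1 f.2
    obtain ⟨h0, h1⟩ := (hV f').1 hf'
    have := hP.green f' g
    rw [h0, h1, inner_zero_right, inner_zero_right, sub_zero, sub_eq_zero] at this
    rw [restrictTo_apply f f' hff', ← hff', this]
  have hdense : Dense ((restrictTo T V).domain : Set H) := by
    rw [Submodule.dense_iff_topologicalClosure_eq_top, Submodule.topologicalClosure_eq_top_iff,
      Submodule.eq_bot_iff]
    intro h hh
    -- With `h = T w`, `Γ₀ w = 0`, orthogonality of `h` to the domain puts `w` into `ker T`.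
    obtain ⟨w, rfl, hw⟩ := hP.exists_apply_eq h
    have hker : ∃ k : T.domain, (k : H) = w ∧ T k = 0 := by
      refine hP.mem_ker_of_orthogonal fun f h0 h1 => ?_
      rw [hP.inner_comm h0 hw]
      exact Submodule.inner_left_of_mem_orthogonal
        (mem_domain_restrictTo.2 ⟨f, (hV f).2 ⟨h0, h1⟩, rfl⟩) hh
    obtain ⟨k, hk, hk0⟩ := hker
    rwa [Subtype.ext hk] at hk0
  refine ⟨hdense, ?_, ?_, ?_, hP.green, ?_⟩
  · -- A limit of the graph lies in the graph of `T ↾ ker Γ₀`, as the latter has a bounded inverse,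
    -- and its second component stays orthogonal to `ker T`.
    obtain ⟨R, hR, hR'⟩ := hP.exists_inverse
    have hgraph : ((restrictTo T V).graph : Set (H × H)) =
        {p | R p.2 = p.1} ∩ ⋂ (k : T.domain) (_ : T k = 0), {p | inner ℂ (k : H) p.2 = 0} := by
      ext ⟨x, h⟩
      simp only [SetLike.mem_coe, LinearPMap.mem_graph_iff, mem_inter_iff, mem_ofPred_eq,
        mem_iInter]
      constructor
      · rintro ⟨f, rfl, rfl⟩
        obtain ⟨f', hf', hff'⟩ := mem_domain_restrictTo.1 f.2
        refine ⟨?_, fun k hk => ?_⟩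
        · rw [restrictTo_apply f f' hff', hR' f' ((hV f').1 hf').1, hff']
        · rw [← hform, hk, inner_zero_left]
      · rintro ⟨rfl, hk⟩
        obtain ⟨f, hf, rfl, hf0⟩ := hR h
        have hf1 := hP.gamma1_eq_zero_of_orthogonal hf0 hk
        exact ⟨⟨R (T f), mem_domain_restrictTo.2 ⟨f, (hV f).2 ⟨hf0, hf1⟩, hf⟩⟩, rfl,
          restrictTo_apply _ f hf⟩
    rw [LinearPMap.IsClosed, hgraph]
    refine (isClosed_eq (by fun_prop) (by fun_prop)).inter
      (isClosed_iInter fun k => isClosed_iInter fun _ => isClosed_eq (by fun_prop) (by fun_prop))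
  · intro f g
    obtain ⟨f', hf', hff'⟩ := mem_domain_restrictTo.1 f.2
    rw [restrictTo_apply f f' hff', hform f' g, hff']
  · have hle : T ≤ (restrictTo T V).adjoint := hform.symm.le_adjoint hdense
    refine (LinearPMap.eq_of_le_of_domain_eq hle (le_antisymm hle.1 fun g hg => ?_)).symm
    obtain ⟨w, hw, hw0⟩ := hP.exists_apply_eq ((restrictTo T V).adjoint ⟨g, hg⟩)
    have hker : ∃ k : T.domain, (k : H) = g - w ∧ T k = 0 := by
      refine hP.mem_ker_of_orthogonal fun f h0 h1 => ?_
      have hfd := mem_domain_restrictTo.2 ⟨f, (hV f).2 ⟨h0, h1⟩, rfl⟩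
      have := LinearPMap.adjoint_isFormalAdjoint hdense ⟨g, hg⟩ ⟨f, hfd⟩
      rw [restrictTo_apply _ f rfl, ← hw] at this
      rw [inner_sub_left, hP.inner_comm h0 hw0, ← this, sub_self]
    obtain ⟨k, hk, -⟩ := hker
    rw [← sub_add_cancel g (w : H), ← hk]
    exact T.domain.add_mem k.2 w.2
  · have hker : LinearMap.range (Γ₁.domRestrict (LinearMap.ker Γ₀)) = ⊤ := by
      rw [← Submodule.orthogonal_eq_bot_iff, Submodule.eq_bot_iff]
      intro y hy
      obtain ⟨k, hk, rfl⟩ := hP.exists_ker y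
      obtain ⟨f, hf, hf0⟩ := hP.exists_apply_eq (k : H)
      have hmem : Γ₁ f ∈ LinearMap.range (Γ₁.domRestrict (LinearMap.ker Γ₀)) :=
        ⟨⟨f, hf0⟩, rfl⟩
      have h1 := hP.green f k
      rw [hk, hf, hf0, inner_zero_left, inner_zero_right, sub_zero, sub_zero,
        Submodule.inner_left_of_mem_orthogonal hmem hy, inner_self_eq_zero] at h1
      rw [(Subtype.ext h1 : k = 0), map_zero]
    rintro ⟨y₀, y₁⟩
    obtain ⟨k, -, rfl⟩ := hP.exists_ker y₀
    obtain ⟨⟨f, hf⟩, hf1⟩ := LinearMap.range_eq_top.1 hker (y₁ - Γ₁ k)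
    have hf0 : Γ₀ f = 0 := hf
    have hf1' : Γ₁ f = y₁ - Γ₁ k := hf1
    exact ⟨k + f, by simp [hf0, hf1']⟩

end IsInvertibleGreenPair

/-- Norm convergence to a self-adjoint operator implies strong resolvent convergence. -/
theorem isStrongResolventLimitBelow_of_tendsto [CompleteSpace G] {M : ℝ → G →L[ℂ] G} {x₀ : ℝ}
    {B : G →L[ℂ] G} (hB : IsSelfAdjoint B) (hM : Tendsto M (𝓝[<] x₀) (𝓝 B)) :
    IsStrongResolventLimitBelow M x₀ B := by
  intro ζ hζ v
  have hu : IsUnit (algebraMap ℂ (G →L[ℂ] G) ζ - B) := by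
    by_contra h
    have := hB.im_eq_zero_of_mem_spectrum (spectrum.mem_iff.2 h)
    exact hζ this
  have h1 : Tendsto (fun x => Ring.inverse (algebraMap ℂ (G →L[ℂ] G) ζ - M x)) (𝓝[<] x₀)
      (𝓝 (Ring.inverse (algebraMap ℂ (G →L[ℂ] G) ζ - B))) := by
    obtain ⟨u, hu⟩ := hu
    have h2 := NormedRing.inverse_continuousAt u
    rw [hu] at h2
    exact h2.tendsto.comp (tendsto_const_nhds.sub hM)
  exact ((ContinuousLinearMap.apply ℂ G v).continuous.tendsto _).comp h1

end AbstractTriplet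

/-! ### Integration by parts for primitives of integrable functions -/

section Primitive

variable {a b : ℝ}

/-- The variation of the primitive of `p` is dominated by that of the primitive of `‖p‖`, which
reduces the claim to real-valued functions. -/
theorem absolutelyContinuousOnInterval_primitive {p : ℝ → ℂ}
    (hp : IntervalIntegrable p volume a b) :
    AbsolutelyContinuousOnInterval (fun x => ∫ t in a..x, p t) a b := by
  have hN := hp.norm.absolutelyContinuousOnInterval_intervalIntegral left_mem_uIcc
  rw [absolutelyContinuousOnInterval_iff] at hN ⊢
  intro ε hε
  obtain ⟨δ, hδ, h⟩ := hN ε hε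
  refine ⟨δ, hδ, fun E hE hEδ => (Finset.sum_le_sum fun i hi => ?_).trans_lt (h E hE hEδ)⟩
  have hmem := hE.1 i hi
  have hi : ∀ x ∈ uIcc a b, IntervalIntegrable p volume a x := fun x hx =>
    hp.mono_set (uIcc_subset_uIcc_left hx)
  rw [dist_comm, dist_comm (∫ t in a..(E.2 i).1, ‖p t‖), dist_eq_norm, dist_eq_norm,
    intervalIntegral.integral_interval_sub_left (hi _ hmem.2) (hi _ hmem.1),
    intervalIntegral.integral_interval_sub_left (hi _ hmem.2).norm (hi _ hmem.1).norm]
  exact intervalIntegral.norm_integral_le_abs_integral_norm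

/-- Integration by parts for functions with integrable, not necessarily continuous, derivatives. -/
theorem integral_mul_add_integral_mul_of_primitive (hab : a < b) {p q P Q : ℝ → ℂ}
    (hp : IntervalIntegrable p volume a b) (hq : IntervalIntegrable q volume a b)
    (hP : ∀ x ∈ Icc a b, P x = P a + ∫ t in a..x, p t)
    (hQ : ∀ x ∈ Icc a b, Q x = Q a + ∫ t in a..x, q t) :
    (∫ x in a..b, p x * Q x) + ∫ x in a..b, P x * q x = P b * Q b - P a * Q a := by
  have hu : uIcc a b = Icc a b := uIcc_of_le hab.le
  set P' : ℝ → ℂ := fun x => P a + ∫ t in a..x, p t with hP'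
  set Q' : ℝ → ℂ := fun x => Q a + ∫ t in a..x, q t with hQ'
  have hc : ∀ c : ℂ, AbsolutelyContinuousOnInterval (fun _ : ℝ => c) a b := fun c =>
    (LipschitzWith.const c).lipschitzOnWith.absolutelyContinuousOnInterval
  have hPac : AbsolutelyContinuousOnInterval P' a b :=
    (hc _).add (absolutelyContinuousOnInterval_primitive hp)
  have hQac : AbsolutelyContinuousOnInterval Q' a b :=
    (hc _).add (absolutelyContinuousOnInterval_primitive hq)
  have h1 : IntervalIntegrable (fun x => p x * Q' x) volume a b :=
    hp.mul_continuousOn hQac.continuousOn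
  have h2 : IntervalIntegrable (fun x => P' x * q x) volume a b :=
    hq.continuousOn_mul hPac.continuousOn
  have h3 := h1.add h2
  -- The difference of the product and of the primitive of its derivative has zero derivative.
  have hD := (hPac.smul hQac).sub (absolutelyContinuousOnInterval_primitive h3)
  obtain ⟨C, hC⟩ := hD.const_of_ae_hasDerivAt_zero (by
    filter_upwards [hp.ae_hasDerivAt_integral, hq.ae_hasDerivAt_integral,
      h3.ae_hasDerivAt_integral] with x hx1 hx2 hx3 hx
    have d1 := ((hx1 hx a left_mem_uIcc).const_add (P a)).mul
      ((hx2 hx a left_mem_uIcc).const_add (Q a))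
    exact (d1.sub (hx3 hx a left_mem_uIcc)).congr_deriv (by simp [hP', hQ']))
  have ha := hC a left_mem_uIcc
  have hb := hC b right_mem_uIcc
  rw [← ha] at hb
  simp only [Pi.sub_apply, smul_eq_mul, Pi.mul_apply, intervalIntegral.integral_same] at hb
  have hPa : P' a = P a := (hP a (left_mem_Icc.2 hab.le)).symm
  have hQa : Q' a = Q a := (hQ a (left_mem_Icc.2 hab.le)).symm
  have hPb : P' b = P b := (hP b (right_mem_Icc.2 hab.le)).symm
  have hQb : Q' b = Q b := (hQ b (right_mem_Icc.2 hab.le)).symm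
  rw [hPa, hQa, hPb, hQb] at hb
  have e1 : ∫ x in a..b, p x * Q x = ∫ x in a..b, p x * Q' x :=
    intervalIntegral.integral_congr fun x hx => by
      simp only [hQ', ← hQ x (hu ▸ hx)]
  have e2 : ∫ x in a..b, P x * q x = ∫ x in a..b, P' x * q x :=
    intervalIntegral.integral_congr fun x hx => by
      simp only [hP', ← hP x (hu ▸ hx)]
  have e3 := intervalIntegral.integral_add h1 h2
  rw [e1, e2, ← e3]
  linear_combination -hb

end Primitive

/-! ### Chains of derivatives -/

namespace IsDerivChain

variable {m : ℕ} {a b : ℝ} {f g : L2 a b} {F F' : ℕ → ℝ → ℂ}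

/-- Repeated integration by parts, moving `j` derivatives from one factor to the other. -/
theorem integral_mul_conj (h : IsDerivChain m a b f F) (h' : IsDerivChain m a b g F')
    (hab : a < b) {j : ℕ} (hj : j ≤ m) :
    ∫ x in a..b, F m x * (starRingEnd ℂ) (F' 0 x) =
      (∑ k ∈ Finset.range j, (-1) ^ k * (F (m - 1 - k) b * (starRingEnd ℂ) (F' k b) -
        F (m - 1 - k) a * (starRingEnd ℂ) (F' k a))) +
      (-1) ^ j * ∫ x in a..b, F (m - j) x * (starRingEnd ℂ) (F' j x) := by
  induction j with
  | zero => simp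
  | succ j ih =>
    have hi := h'.intervalIntegrable hab (j + 1) hj
    have hconj : IntervalIntegrable (fun x => (starRingEnd ℂ) (F' (j + 1) x)) volume a b := by
      rw [intervalIntegrable_iff] at hi ⊢
      exact Complex.conjCLE.toContinuousLinearMap.integrable_comp hi
    have hm : m - 1 - j + 1 = m - j := by omega
    have key := integral_mul_add_integral_mul_of_primitive hab
      (h.intervalIntegrable hab (m - j) (by omega)) hconj (P := F (m - 1 - j))
      (Q := fun x => (starRingEnd ℂ) (F' j x))
      (fun x hx => by rw [h.primitive (m - 1 - j) (by omega) x hx, hm])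
      (fun x hx => by
        rw [h'.primitive j (by omega) x hx, map_add, intervalIntegral.intervalIntegral_conj])
    rw [ih (by omega), Finset.sum_range_succ, show m - (j + 1) = m - 1 - j by omega]
    linear_combination (-1) ^ j * key

/-- Taylor's formula for a chain whose highest derivative vanishes, with the derivatives indexed
downwards from the highest one. -/
theorem eq_sum_of_ae_zero (h : IsDerivChain m a b f F)
    (h0 : F m =ᵐ[volume.restrict (Ioo a b)] 0) {r : ℕ} (hr : r < m) {x : ℝ} (hx : x ∈ Icc a b) :
    F (m - 1 - r) x = ∑ j ∈ Finset.range (r + 1),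
      F (m - 1 - j) a * (((x - a : ℝ) : ℂ) ^ (r - j) / (r - j).factorial) := by
  induction r generalizing x with
  | zero =>
    rw [h.primitive _ (by omega) x hx, Nat.sub_zero, Nat.sub_add_cancel (by omega)]
    have : ∫ t in a..x, F m t = 0 := by
      rw [intervalIntegral.integral_of_le hx.1, integral_Ioc_eq_integral_Ioo]
      refine integral_eq_zero_of_ae (h0.filter_mono (ae_mono ?_))
      exact Measure.restrict_mono (Ioo_subset_Ioo_right hx.2) le_rfl
    simp [this]
  | succ r ih =>
    have hm : m - 1 - (r + 1) + 1 = m - 1 - r := by omega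
    have hmono : ∀ k : ℕ, ∫ t in a..x, ((t - a : ℝ) : ℂ) ^ k / (k.factorial : ℂ) =
        ((x - a : ℝ) : ℂ) ^ (k + 1) / ((k + 1).factorial : ℂ) := by
      intro k
      have hd : ∀ t : ℝ, HasDerivAt (fun t : ℝ =>
          ((t - a : ℝ) : ℂ) ^ (k + 1) / ((k + 1).factorial : ℂ))
          (((t - a : ℝ) : ℂ) ^ k / (k.factorial : ℂ)) t := by
        intro t
        have h1 := ((((hasDerivAt_id t).sub_const a).ofReal_comp).pow (k + 1)).div_const
          ((k + 1).factorial : ℂ)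
        refine h1.congr_deriv ?_
        have := Nat.cast_ne_zero (R := ℂ).2 k.factorial_ne_zero
        have h2 : (k + 1 : ℂ) ≠ 0 := by exact_mod_cast k.succ_ne_zero
        rw [Nat.factorial_succ]
        push_cast
        simp only [id]
        field_simp
      rw [intervalIntegral.integral_eq_sub_of_hasDerivAt (fun t _ => hd t)
        (Continuous.intervalIntegrable (by fun_prop) _ _)]
      simp
    rw [h.primitive _ (by omega) x hx, hm, Finset.sum_range_succ]
    have e : ∫ t in a..x, F (m - 1 - r) t = ∫ t in a..x, ∑ j ∈ Finset.range (r + 1),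
        F (m - 1 - j) a * (((t - a : ℝ) : ℂ) ^ (r - j) / (r - j).factorial) :=
      intervalIntegral.integral_congr fun t ht => by
        rw [uIcc_of_le hx.1] at ht
        exact ih (by omega) ⟨ht.1, ht.2.trans hx.2⟩
    rw [e, intervalIntegral.integral_finsetSum
      fun j _ => Continuous.intervalIntegrable (by fun_prop) _ _]
    simp only [intervalIntegral.integral_const_mul, hmono]
    rw [Finset.sum_congr rfl fun j hj => by
      rw [show r - j + 1 = r + 1 - j by have := Finset.mem_range.1 hj; omega]]
    simp [add_comm]

end IsDerivChain

/-- Every `h ∈ L²(a,b)` is the `m`-th derivative of a function with prescribed Taylor coefficients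
at `a`. -/
theorem exists_isDerivChain {a b : ℝ} (hab : a < b) {m : ℕ} (hm : 1 ≤ m) (h : L2 a b)
    (c : ℕ → ℂ) : ∃ f F, IsDerivChain m a b f F ∧ F m = h ∧ ∀ k < m, F k a = c k := by
  -- `P j` is the derivative of order `m - j`, obtained from `h` by integrating `j` times.
  let P : ℕ → ℝ → ℂ := fun j =>
    Nat.rec (h : ℝ → ℂ) (fun j G x => c (m - 1 - j) + ∫ t in a..x, G t) j
  have hP : ∀ j x, P (j + 1) x = c (m - 1 - j) + ∫ t in a..x, P j t := fun j x => rfl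
  have hstep : ∀ k < m, ∀ x, P (m - k) x = c k + ∫ t in a..x, P (m - (k + 1)) t := by
    intro k hk x
    rw [show m - k = m - (k + 1) + 1 by omega, hP, show m - 1 - (m - (k + 1)) = k by omega]
  have hcont : ∀ j, IntervalIntegrable (P j) volume a b → ContinuousOn (P (j + 1)) (Icc a b) := by
    intro j hj
    have h1 := intervalIntegral.continuousOn_primitive_interval' hj left_mem_uIcc
    rw [uIcc_of_le hab.le] at h1
    exact continuousOn_const.add h1
  have hint : ∀ j, IntervalIntegrable (P j) volume a b := by
    intro j
    induction j with
    | zero =>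
      rw [intervalIntegrable_iff_integrableOn_Ioo_of_le hab.le]
      exact (Lp.memLp h).integrable (by norm_num)
    | succ j ih =>
      have := hcont j ih
      rw [← uIcc_of_le hab.le] at this
      exact this.intervalIntegrable
  have hL : MemLp (P m) 2 (volume.restrict (Ioo a b)) := by
    obtain ⟨j, rfl⟩ := Nat.exists_eq_add_of_le' hm
    have hc := hcont j (hint j)
    obtain ⟨C, hC⟩ := isCompact_Icc.exists_bound_of_continuousOn hc
    refine MemLp.of_bound ((hc.mono Ioo_subset_Icc_self).aestronglyMeasurable measurableSet_Ioo) C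
      ?_
    filter_upwards [ae_restrict_mem measurableSet_Ioo] with x hx
    exact hC x (Ioo_subset_Icc_self hx)
  refine ⟨hL.toLp, fun k => P (m - k), ⟨hL.coeFn_toLp, ?_, fun k hk x _ => ?_⟩, ?_, fun k hk => ?_⟩
  · simpa [P] using Lp.memLp h
  · rw [hstep k hk x, hstep k hk a, intervalIntegral.integral_same, add_zero]
  · simp [P]
  · simp [hstep k hk a]

section Sobolev

variable {m : ℕ} {a b : ℝ} {hab : a < b}

theorem derivAt_eq {f : sobolev m hab} {F : ℕ → ℝ → ℂ} (h : IsDerivChain m a b (f : L2 a b) F)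
    (k : Fin m) (x : Icc a b) : derivAt hab k x f = F k x :=
  (isDerivChain_derivChain f).unique h hab k.2 x.2

theorem topDeriv_ae_eq {f : sobolev m hab} {F : ℕ → ℝ → ℂ}
    (h : IsDerivChain m a b (f : L2 a b) F) :
    topDeriv hab f =ᵐ[volume.restrict (Ioo a b)] F m :=
  (MemLp.coeFn_toLp (isDerivChain_derivChain f).memLp).trans
    ((isDerivChain_derivChain f).unique_ae h hab)

theorem inner_eq_intervalIntegral (f g : L2 a b) (hab : a < b) {u v : ℝ → ℂ}
    (hf : f =ᵐ[volume.restrict (Ioo a b)] u) (hg : g =ᵐ[volume.restrict (Ioo a b)] v) :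
    inner ℂ g f = ∫ x in a..b, u x * (starRingEnd ℂ) (v x) := by
  rw [L2.inner_def, intervalIntegral.integral_of_le hab.le, integral_Ioc_eq_integral_Ioo]
  refine integral_congr_ae ?_
  filter_upwards [hf, hg] with x h1 h2
  rw [h1, h2, RCLike.inner_apply]

/-- Lagrange's identity for the highest derivative of even order. -/
theorem inner_topDeriv_sub (n : ℕ) {f g : sobolev (2 * n) hab} {F G : ℕ → ℝ → ℂ}
    (hF : IsDerivChain (2 * n) a b (f : L2 a b) F) (hG : IsDerivChain (2 * n) a b (g : L2 a b) G) :
    inner ℂ (g : L2 a b) (topDeriv hab f) - inner ℂ (topDeriv hab g) (f : L2 a b) =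
      ∑ k ∈ Finset.range (2 * n), (-1) ^ k *
        (F (2 * n - 1 - k) b * (starRingEnd ℂ) (G k b) -
          F (2 * n - 1 - k) a * (starRingEnd ℂ) (G k a)) := by
  rw [inner_eq_intervalIntegral _ _ hab (topDeriv_ae_eq hF) hG.ae_eq,
    inner_eq_intervalIntegral _ _ hab hF.ae_eq (topDeriv_ae_eq hG),
    hF.integral_mul_conj hG hab le_rfl, Nat.sub_self, pow_mul]
  simp

end Sobolev

/-! ### Green's identity for the maximal operator -/

section Operator

variable (n : ℕ) {a b : ℝ} (hab : a < b)

theorem exists_maxOp_apply_eq (hn : 1 ≤ n) (h : L2 a b) (c : ℕ → ℂ) :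
    ∃ (f : (maxOp n hab).domain) (F : ℕ → ℝ → ℂ), IsDerivChain (2 * n) a b (f : L2 a b) F ∧
      maxOp n hab f = h ∧ ∀ k < 2 * n, F k a = c k := by
  obtain ⟨f, F, hF, hFm, hFa⟩ :=
    exists_isDerivChain hab (m := 2 * n) (by omega) ((-1 : ℂ) ^ n • h) c
  refine ⟨⟨f, F, hF⟩, F, hF, ?_, hFa⟩
  have ht : topDeriv hab ⟨f, F, hF⟩ = (-1 : ℂ) ^ n • h := by
    refine Lp.ext ((topDeriv_ae_eq (f := ⟨f, F, hF⟩) hF).trans ?_)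
    rw [hFm]
  change (-1 : ℂ) ^ n • topDeriv hab ⟨f, F, hF⟩ = h
  rw [ht, smul_smul, ← mul_pow]
  simp

theorem ae_zero_of_maxOp_eq_zero {f : (maxOp n hab).domain} {F : ℕ → ℝ → ℂ}
    (hF : IsDerivChain (2 * n) a b (f : L2 a b) F) (hf : maxOp n hab f = 0) :
    F (2 * n) =ᵐ[volume.restrict (Ioo a b)] 0 := by
  have h1 : (-1 : ℂ) ^ n • topDeriv hab f = 0 := hf
  have h2 : topDeriv hab f = 0 := by simpa using h1
  refine (topDeriv_ae_eq (hab := hab) (f := f) hF).symm.trans ?_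
  rw [h2]
  exact Lp.coeFn_zero _ _ _

section BoundaryValues

variable {n} {hab} {f : (maxOp n hab).domain} {F : ℕ → ℝ → ℂ}
  (hF : IsDerivChain (2 * n) a b (f : L2 a b) F) (i : Fin n)
include hF

theorem Gamma0_inl : Gamma0 n hab f (Sum.inl i) = F i a :=
  derivAt_eq (f := f) hF ⟨i, by omega⟩ _

theorem Gamma0_inr : Gamma0 n hab f (Sum.inr i) = F i b :=
  derivAt_eq (f := f) hF ⟨i, by omega⟩ _

theorem Gamma1_inl : Gamma1 n hab f (Sum.inl i) = (-1) ^ (n - 1 - i.1) * F (2 * n - 1 - i) a :=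
  congrArg ((-1) ^ (n - 1 - i.1) * ·) (derivAt_eq (hab := hab) (f := f) hF
    ⟨2 * n - 1 - i, by omega⟩ ⟨a, left_mem_Icc.2 hab.le⟩)

theorem Gamma1_inr : Gamma1 n hab f (Sum.inr i) = (-1) ^ (n - i.1) * F (2 * n - 1 - i) b :=
  congrArg ((-1) ^ (n - i.1) * ·) (derivAt_eq (hab := hab) (f := f) hF
    ⟨2 * n - 1 - i, by omega⟩ ⟨b, right_mem_Icc.2 hab.le⟩)

end BoundaryValues

theorem maxOp_green (f g : (maxOp n hab).domain) :
    inner ℂ (g : L2 a b) (maxOp n hab f) - inner ℂ (maxOp n hab g) (f : L2 a b) =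
      inner ℂ (Gamma0 n hab g) (Gamma1 n hab f) - inner ℂ (Gamma1 n hab g) (Gamma0 n hab f) := by
  obtain ⟨F, hF⟩ := f.2
  obtain ⟨G, hG⟩ := g.2
  have e : inner ℂ (g : L2 a b) (maxOp n hab f) - inner ℂ (maxOp n hab g) (f : L2 a b) =
      (-1) ^ n * (inner ℂ (g : L2 a b) (topDeriv hab f) -
        inner ℂ (topDeriv hab g) (f : L2 a b)) := by
    change inner ℂ (g : L2 a b) ((-1 : ℂ) ^ n • topDeriv hab f) -
      inner ℂ ((-1 : ℂ) ^ n • topDeriv hab g) (f : L2 a b) = _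
    rw [inner_smul_right, inner_smul_left, mul_sub]
    simp
  rw [e, inner_topDeriv_sub n hF hG]
  simp only [PiLp.inner_apply, Fintype.sum_sum_type, RCLike.inner_apply, Gamma0_inl hF,
    Gamma0_inl hG, Gamma0_inr hF, Gamma0_inr hG, Gamma1_inl hF, Gamma1_inl hG, Gamma1_inr hF,
    Gamma1_inr hG]
  -- The terms with `k < n` and `k ≥ n` make up the first and the second inner product.
  rw [two_mul, Finset.sum_range_add, ← two_mul,
    ← Finset.sum_range_reflect (fun x => (-1 : ℂ) ^ (n + x) * _),
    Finset.sum_range, Finset.sum_range, ← Finset.sum_add_distrib, ← Finset.sum_add_distrib,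
    ← Finset.sum_add_distrib, ← Finset.sum_sub_distrib, Finset.mul_sum]
  refine Finset.sum_congr rfl fun i _ => ?_
  obtain ⟨d, hd⟩ : ∃ d, n = i + 1 + d := ⟨n - (i + 1), by omega⟩
  have h1 : n + (n - 1 - i) = 2 * n - 1 - i := by omega
  have h2 : 2 * n - 1 - (2 * n - 1 - i) = i := by omega
  have s1 : (-1 : ℂ) ^ (2 * n - 1 - i) = (-1) ^ (i.1 + 1) := by
    rw [show 2 * n - 1 - i = 2 * d + (i.1 + 1) by omega, pow_add, pow_mul]
    simp
  have s2 : (-1 : ℂ) ^ (n - 1 - i) = (-1) ^ d := by congr 1; omega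
  have s3 : (-1 : ℂ) ^ (n - i) = (-1) ^ (d + 1) := by congr 1; omega
  have s4 : (-1 : ℂ) ^ n = (-1) ^ (i + 1 + d) := by congr 1
  have s5 : (-1 : ℂ) ^ (i : ℕ) * (-1) ^ (i : ℕ) = 1 := by rw [← mul_pow]; simp
  rw [h1, h2, s1, s2, s3, s4]
  simp only [map_mul, map_pow, map_neg, map_one, pow_add, pow_one]
  linear_combination (-1) ^ d * (
    - (F (2 * n - 1 - i) b * (starRingEnd ℂ) (G i b) -
        F (2 * n - 1 - i) a * (starRingEnd ℂ) (G i a)) +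
      (F i b * (starRingEnd ℂ) (G (2 * n - 1 - i) b) -
        F i a * (starRingEnd ℂ) (G (2 * n - 1 - i) a))) * s5

theorem mem_iInf_ker_derivAt_iff {m : ℕ} {f : sobolev m hab} {F : ℕ → ℝ → ℂ}
    (hF : IsDerivChain m a b (f : L2 a b) F) :
    f ∈ (⨅ k : Fin m, LinearMap.ker (derivAt hab k ⟨a, left_mem_Icc.2 hab.le⟩) ⊓
      LinearMap.ker (derivAt hab k ⟨b, right_mem_Icc.2 hab.le⟩)) ↔
      ∀ k < m, F k a = 0 ∧ F k b = 0 := by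
  simp only [Submodule.mem_iInf, Submodule.mem_inf, LinearMap.mem_ker, derivAt_eq hF]
  exact ⟨fun h k hk => h ⟨k, hk⟩, fun h k => h k k.2⟩

/-- The boundary conditions defining the minimal operator are `Γ₀ f = Γ₁ f = 0`. -/
theorem mem_iInf_ker_derivAt_iff_Gamma (f : (maxOp n hab).domain) :
    f ∈ (⨅ k : Fin (2 * n), LinearMap.ker (derivAt hab k ⟨a, left_mem_Icc.2 hab.le⟩) ⊓
      LinearMap.ker (derivAt hab k ⟨b, right_mem_Icc.2 hab.le⟩)) ↔
      Gamma0 n hab f = 0 ∧ Gamma1 n hab f = 0 := by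
  obtain ⟨F, hF⟩ := f.2
  refine (mem_iInf_ker_derivAt_iff hab (f := f) hF).trans ?_
  constructor
  · intro h
    constructor <;> ext (i | i)
    · rw [Gamma0_inl hF, (h i (by omega)).1]; rfl
    · rw [Gamma0_inr hF, (h i (by omega)).2]; rfl
    · rw [Gamma1_inl hF, (h _ (by omega)).1, mul_zero]; rfl
    · rw [Gamma1_inr hF, (h _ (by omega)).2, mul_zero]; rfl
  · rintro ⟨h0, h1⟩ k hk
    rcases lt_or_ge k n with hkn | hkn
    · have ha := Gamma0_inl hF ⟨k, hkn⟩
      have hb := Gamma0_inr hF ⟨k, hkn⟩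
      rw [h0] at ha hb
      exact ⟨ha.symm, hb.symm⟩
    · have ha := Gamma1_inl hF ⟨2 * n - 1 - k, by omega⟩
      have hb := Gamma1_inr hF ⟨2 * n - 1 - k, by omega⟩
      rw [h1, show 2 * n - 1 - (2 * n - 1 - k) = k by omega] at ha hb
      constructor
      · simpa using ha.symm
      · simpa using hb.symm

end Operator

/-! ### Boundary values on the kernel of the maximal operator -/

section Kernel

variable {n : ℕ} {a b : ℝ} {f : L2 a b} {F : ℕ → ℝ → ℂ}

open Matrix

/-- The derivatives of order `≥ n` at `b`, in decreasing order, of a polynomial of degree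
`< 2 * n`. -/
theorem matT1_mulVec (hab : a < b) (hF : IsDerivChain (2 * n) a b f F)
    (h0 : F (2 * n) =ᵐ[volume.restrict (Ioo a b)] 0) (i : Fin n) :
    (matT1 n a b *ᵥ fun j : Fin n => F (2 * n - 1 - j) a) i = F (2 * n - 1 - i) b := by
  rw [hF.eq_sum_of_ae_zero h0 (by omega) (right_mem_Icc.2 hab.le)]
  have hsum := Finset.sum_range (n := n) fun j : ℕ => if j ≤ i.1 then
    F (2 * n - 1 - j) a * (((b - a : ℝ) : ℂ) ^ (i.1 - j) / ((i.1 - j).factorial : ℂ)) else 0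
  rw [← Finset.sum_filter, show (Finset.range n).filter (fun j : ℕ => j ≤ i.1) =
    Finset.range (i.1 + 1) by ext j; simp; omega] at hsum
  rw [hsum, mulVec, dotProduct]
  refine Finset.sum_congr rfl fun j _ => ?_
  simp only [matT1, of_apply, Fin.le_def]
  split_ifs
  · ring
  · simp

/-- The derivatives of order `< n` at `b`, in decreasing order, of a polynomial of degree
`< 2 * n`. -/
theorem matT2_mulVec_add (hab : a < b) (hF : IsDerivChain (2 * n) a b f F)
    (h0 : F (2 * n) =ᵐ[volume.restrict (Ioo a b)] 0) (i : Fin n) :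
    (matT2 n a b *ᵥ fun j : Fin n => F (2 * n - 1 - j) a) i +
      (matT1 n a b *ᵥ fun j : Fin n => F (n - 1 - j) a) i = F (n - 1 - i) b := by
  have h := hF.eq_sum_of_ae_zero h0 (r := n + i) (by omega) (right_mem_Icc.2 hab.le)
  rw [show 2 * n - 1 - (n + i) = n - 1 - i by omega, add_assoc, Finset.sum_range_add] at h
  rw [h]
  congr 1
  · rw [Finset.sum_range, mulVec, dotProduct]
    refine Finset.sum_congr rfl fun j _ => ?_
    simp only [matT2, of_apply]
    ring
  · have hsum := Finset.sum_range (n := n) fun j : ℕ => if j ≤ i.1 then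
      F (2 * n - 1 - (n + j)) a * (((b - a : ℝ) : ℂ) ^ (n + i.1 - (n + j)) /
        ((n + i.1 - (n + j)).factorial : ℂ)) else 0
    rw [← Finset.sum_filter, show (Finset.range n).filter (fun j : ℕ => j ≤ i.1) =
      Finset.range (i.1 + 1) by ext j; simp; omega] at hsum
    rw [hsum, mulVec, dotProduct]
    refine Finset.sum_congr rfl fun j _ => ?_
    simp only [matT1, of_apply, Fin.le_def]
    rw [show 2 * n - 1 - (n + j) = n - 1 - j by omega, show n + i.1 - (n + j) = i - j by omega]
    split_ifs
    · ring
    · simp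

/-- `S` reverses the order of the coordinates. -/
theorem matS_mulVec (v : ℕ → ℂ) (i : Fin n) :
    (matS n *ᵥ fun j : Fin n => v j) i = v (n - 1 - i) := by
  simp only [mulVec, dotProduct, matS, of_apply]
  rw [Finset.sum_eq_single ⟨n - 1 - i, by omega⟩]
  · rw [if_pos (by simp only; omega), one_mul]
  · intro j _ hj
    rw [if_neg, zero_mul]
    intro h
    exact hj (Fin.ext (by simp only; omega))
  · simp

/-- A polynomial of degree `< 2 * n` whose derivatives of order `< n` vanish at both end points is
zero, by the identity `(-1)ⁿ ∫ f^{(2n)} f̄ = ∫ |f^{(n)}|²`. -/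
theorem eq_zero_of_boundary_eq_zero (hab : a < b) (hF : IsDerivChain (2 * n) a b f F)
    (h0 : F (2 * n) =ᵐ[volume.restrict (Ioo a b)] 0) (ha : ∀ k < n, F k a = 0)
    (hb : ∀ k < n, F k b = 0) {k : ℕ} (hk : k < n) : F (n + k) a = 0 := by
  have hIBP := hF.integral_mul_conj hF hab (j := n) (by omega)
  rw [Finset.sum_eq_zero fun k hk => by
    rw [ha k (Finset.mem_range.1 hk), hb k (Finset.mem_range.1 hk)]; simp,
    show 2 * n - n = n by omega, zero_add] at hIBP
  have hl : ∫ x in a..b, F (2 * n) x * (starRingEnd ℂ) (F 0 x) = 0 := by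
    rw [intervalIntegral.integral_of_le hab.le, integral_Ioc_eq_integral_Ioo]
    refine integral_eq_zero_of_ae ?_
    filter_upwards [h0] with x hx
    simp [hx]
  rw [hl, eq_comm, mul_eq_zero, or_iff_right (by simp)] at hIBP
  have hc := hF.continuousOn hab (show n < 2 * n by omega)
  have hsq : ∫ x in Ioo a b, ‖F n x‖ ^ 2 = 0 := by
    rw [intervalIntegral.integral_of_le hab.le, integral_Ioc_eq_integral_Ioo] at hIBP
    simp only [Complex.mul_conj'] at hIBP
    have : ∫ x in Ioo a b, ((‖F n x‖ ^ 2 : ℝ) : ℂ) = 0 := by simpa using hIBP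
    exact Complex.ofReal_eq_zero.1 ((integral_ofReal (𝕜 := ℂ)).symm.trans this)
  have hint : IntegrableOn (fun x => ‖F n x‖ ^ 2) (Ioo a b) :=
    ((hc.norm.pow 2).integrableOn_Icc).mono_set Ioo_subset_Icc_self
  have hae := (integral_eq_zero_iff_of_nonneg (fun x => by positivity) hint).1 hsq
  -- Now `F n` vanishes almost everywhere, so it starts a chain of derivatives of `0`.
  have hchain : IsDerivChain n a b 0 fun k => F (n + k) :=
    { ae_eq := by
        filter_upwards [Lp.coeFn_zero ℂ 2 (volume.restrict (Ioo a b)), hae] with x h1 h2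
        rw [h1]
        simpa [eq_comm] using h2
      memLp := by rw [← two_mul]; exact hF.memLp
      primitive := fun k hk x hx => hF.primitive (n + k) (by omega) x hx }
  exact hchain.eq_zero hab hk (left_mem_Icc.2 hab.le)

/-- Solutions of the polynomial problem with vanishing Taylor coefficients of order `< n` at `a`
are parametrised by `T₂`, which is therefore injective. -/
theorem isUnit_det_matT2 (hn : 1 ≤ n) (hab : a < b) : IsUnit (matT2 n a b).det := by
  rw [isUnit_iff_ne_zero]
  intro hdet
  obtain ⟨v, hv, hTv⟩ := exists_mulVec_eq_zero_iff.2 hdet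
  let c : ℕ → ℂ := fun k => if h : n ≤ k ∧ k < 2 * n then v ⟨2 * n - 1 - k, by omega⟩ else 0
  obtain ⟨f, F, hF, hF0, hFa⟩ := exists_isDerivChain hab (m := 2 * n) (by omega) 0 c
  have h0 : F (2 * n) =ᵐ[volume.restrict (Ioo a b)] 0 := by
    rw [hF0]
    exact Lp.coeFn_zero _ _ _
  have ha : ∀ k < n, F k a = 0 := fun k hk => by
    rw [hFa k (by omega)]
    exact dif_neg (by omega)
  have hvF : (fun j : Fin n => F (2 * n - 1 - j) a) = v := by
    funext j
    rw [hFa _ (by omega)]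
    refine (dif_pos (by omega)).trans ?_
    congr 1
    exact Fin.ext (by simp only; omega)
  have hb : ∀ k < n, F k b = 0 := fun k hk => by
    have := matT2_mulVec_add hab hF h0 ⟨n - 1 - k, by omega⟩
    rw [hvF, hTv, show (fun j : Fin n => F (n - 1 - j) a) = 0 from
      funext fun j => ha _ (by omega), mulVec_zero, show n - 1 - (n - 1 - k) = k by omega] at this
    simpa using this.symm
  refine hv (funext fun j => ?_)
  rw [← hvF]
  have := eq_zero_of_boundary_eq_zero hab hF h0 ha hb (k := n - 1 - j) (by omega)
  rwa [show n + (n - 1 - j) = 2 * n - 1 - j by omega] at this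

theorem matT2_mul_inv (hn : 1 ≤ n) (hab : a < b) : matT2 n a b * (matT2 n a b)⁻¹ = 1 :=
  mul_nonsing_inv _ (isUnit_det_matT2 hn hab)

theorem matT2_inv_mul (hn : 1 ≤ n) (hab : a < b) : (matT2 n a b)⁻¹ * matT2 n a b = 1 :=
  nonsing_inv_mul _ (isUnit_det_matT2 hn hab)

/-- The two-point problem of prescribing the derivatives of order `< n` at both end points is
solvable by a polynomial of degree `< 2 * n`, since `T₂` is invertible. -/
theorem exists_maxOp_eq_zero_Gamma0_eq (hn : 1 ≤ n) (hab : a < b) (y : BoundarySpace n) :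
    ∃ k : (maxOp n hab).domain, maxOp n hab k = 0 ∧ Gamma0 n hab k = y := by
  let u : ℕ → ℂ := fun k => if h : k < n then y (Sum.inl ⟨k, h⟩) else 0
  let w : ℕ → ℂ := fun k => if h : k < n then y (Sum.inr ⟨k, h⟩) else 0
  -- The derivatives of order `≥ n` at `a`, in decreasing order.
  let v : Fin n → ℂ := (matT2 n a b)⁻¹ *ᵥ
    ((fun j : Fin n => w (n - 1 - j)) - matT1 n a b *ᵥ fun j : Fin n => u (n - 1 - j))
  let c : ℕ → ℂ := fun k =>
    if k < n then u k else if h : 2 * n - 1 - k < n then v ⟨2 * n - 1 - k, h⟩ else 0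
  obtain ⟨f, F, hF, hf, hFa⟩ := exists_maxOp_apply_eq n hab hn 0 c
  have ha : ∀ k < n, F k a = u k := fun k hk => by
    rw [hFa k (by omega)]
    exact if_pos hk
  have hvF : (fun j : Fin n => F (2 * n - 1 - j) a) = v := by
    funext j
    rw [hFa _ (by omega)]
    refine (if_neg (by omega)).trans ((dif_pos (by omega)).trans ?_)
    congr 1
    exact Fin.ext (by simp only; omega)
  have huF : (fun j : Fin n => F (n - 1 - j) a) = fun j : Fin n => u (n - 1 - j) :=
    funext fun j => ha _ (by omega)
  refine ⟨f, hf, ?_⟩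
  ext (i | i)
  · rw [Gamma0_inl hF, ha i i.2]
    exact dif_pos i.2
  · have h := matT2_mulVec_add hab hF (ae_zero_of_maxOp_eq_zero n hab hF hf)
      ⟨n - 1 - i, by omega⟩
    rw [hvF, huF, mulVec_mulVec, matT2_mul_inv hn hab, one_mulVec, Pi.sub_apply, sub_add_cancel,
      show n - 1 - (n - 1 - i) = (i : ℕ) by omega] at h
    rw [Gamma0_inr hF, ← h]
    exact dif_pos i.2

/-- On the kernel of the maximal operator the boundary maps are related by `B_K`. -/
theorem toEuclideanCLM_matBK_Gamma0 (hn : 1 ≤ n) (hab : a < b) {k : (maxOp n hab).domain}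
    (hk : maxOp n hab k = 0) :
    Matrix.toEuclideanCLM (𝕜 := ℂ) (matBK n a b) (Gamma0 n hab k) = Gamma1 n hab k := by
  obtain ⟨F, hF⟩ := k.2
  have h0 := ae_zero_of_maxOp_eq_zero n hab hF hk
  set v : Fin n → ℂ := fun j => F (2 * n - 1 - j) a with hv
  set u : Fin n → ℂ := fun j => F j a with hu
  set w : Fin n → ℂ := fun j => F j b with hw
  have hT2 : matT2 n a b *ᵥ v + matT1 n a b *ᵥ (matS n *ᵥ u) = matS n *ᵥ w := by
    funext i
    rw [Pi.add_apply, show matS n *ᵥ u = _ from funext (matS_mulVec fun k => F k a),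
      matS_mulVec fun k => F k b]
    exact matT2_mulVec_add hab hF h0 i
  have hv' : (matT2 n a b)⁻¹ *ᵥ (matS n *ᵥ w) -
      (matT2 n a b)⁻¹ *ᵥ (matT1 n a b *ᵥ (matS n *ᵥ u)) = v := by
    rw [← mulVec_sub, ← hT2, add_sub_cancel_right, mulVec_mulVec, matT2_inv_mul hn hab,
      one_mulVec]
  have hΓ : WithLp.ofLp (Gamma0 n hab k) = Sum.elim u w := by
    funext x
    rcases x with i | i
    · exact Gamma0_inl hF i
    · exact Gamma0_inr hF i
  have hQ : ∀ x : Fin n → ℂ, ∀ i, (matQ n *ᵥ x) i = (-1) ^ (n - i.1) * x i := fun x i => by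
    rw [matQ, mulVec_diagonal]
  have h1 : (matQ n * (matT2 n a b)⁻¹ * matT1 n a b * matS n) *ᵥ u +
      (-(matQ n * (matT2 n a b)⁻¹ * matS n)) *ᵥ w = -(matQ n *ᵥ v) := by
    rw [← hv']
    simp only [neg_mulVec, ← mulVec_mulVec, mulVec_sub]
    abel
  have h2 : (-(matQ n * matT1 n a b * (matT2 n a b)⁻¹ * matT1 n a b * matS n)) *ᵥ u +
      (matQ n * matT1 n a b * (matT2 n a b)⁻¹ * matS n) *ᵥ w =
      matQ n *ᵥ (matT1 n a b *ᵥ v) := by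
    rw [← hv']
    simp only [neg_mulVec, ← mulVec_mulVec, mulVec_sub]
    abel
  ext x
  rw [Matrix.ofLp_toEuclideanCLM, hΓ, matBK, fromBlocks_mulVec, Sum.elim_comp_inl,
    Sum.elim_comp_inr, h1, h2]
  rcases x with i | i
  · rw [Gamma1_inl hF, Sum.elim_inl, Pi.neg_apply, hQ,
      show n - i.1 = n - 1 - i + 1 by omega, pow_succ]
    simp [hv]
  · rw [Gamma1_inr hF, Sum.elim_inr, hQ, hv, matT1_mulVec hab hF h0]

theorem isInvertibleGreenPair_maxOp (hn : 1 ≤ n) (hab : a < b) :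
    IsInvertibleGreenPair (maxOp n hab) (Gamma0 n hab) (Gamma1 n hab) where
  green := maxOp_green n hab
  surjective h := by
    obtain ⟨f, -, -, hf, -⟩ := exists_maxOp_apply_eq n hab hn h 0
    exact ⟨f, hf⟩
  exists_ker := exists_maxOp_eq_zero_Gamma0_eq hn hab

theorem weylFunction_zero_eq_matBK (hn : 1 ≤ n) (hab : a < b) :
    weylFunction (Gamma0 n hab) (Gamma1 n hab) 0 =
      Matrix.toEuclideanCLM (𝕜 := ℂ) (matBK n a b) := by
  ext1 y
  obtain ⟨k, hk, rfl⟩ := exists_maxOp_eq_zero_Gamma0_eq hn hab y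
  rw [(isInvertibleGreenPair_maxOp hn hab).weylFunction_zero hk,
    toEuclideanCLM_matBK_Gamma0 hn hab hk]

end Kernel

end BoundaryTriplets

theorem mainTheorem3 (n : ℕ) (hn : 1 ≤ n) (a b : ℝ) (hab : a < b) :
    BoundaryTriplets.IsBoundaryTriplet (BoundaryTriplets.minOp n hab)
      (BoundaryTriplets.Gamma0 n hab) (BoundaryTriplets.Gamma1 n hab) ∧
    BoundaryTriplets.resolventSet (BoundaryTriplets.dirichletOp n hab) ∈ 𝓝 (0 : ℂ) ∧
    IsUnit (BoundaryTriplets.matT2 n a b).det ∧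
    Tendsto
      (BoundaryTriplets.weylFunction (BoundaryTriplets.Gamma0 n hab)
        (BoundaryTriplets.Gamma1 n hab))
      (𝓝[≠] (0 : ℂ))
      (𝓝 (Matrix.toEuclideanCLM (𝕜 := ℂ) (BoundaryTriplets.matBK n a b))) ∧
    BoundaryTriplets.weylFunction (BoundaryTriplets.Gamma0 n hab)
      (BoundaryTriplets.Gamma1 n hab) 0 =
        Matrix.toEuclideanCLM (𝕜 := ℂ) (BoundaryTriplets.matBK n a b) ∧
    BoundaryTriplets.IsStrongResolventLimitBelow
      (fun x : ℝ => BoundaryTriplets.weylFunction (BoundaryTriplets.Gamma0 n hab)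
        (BoundaryTriplets.Gamma1 n hab) (x : ℂ)) 0
      (Matrix.toEuclideanCLM (𝕜 := ℂ) (BoundaryTriplets.matBK n a b)) ∧
    (BoundaryTriplets.matBK n a b).IsHermitian := by
  have hP := BoundaryTriplets.isInvertibleGreenPair_maxOp hn hab
  have h0 := BoundaryTriplets.weylFunction_zero_eq_matBK hn hab
  have hc := hP.continuousAt_weylFunction_zero
  have hsa := hP.isSelfAdjoint_weylFunction_zero
  rw [ContinuousAt, h0] at hc
  rw [h0] at hsa
  refine ⟨hP.isBoundaryTriplet (BoundaryTriplets.mem_iInf_ker_derivAt_iff_Gamma n hab),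
    hP.resolventSet_mem_nhds,
    BoundaryTriplets.isUnit_det_matT2 hn hab, hc.mono_left nhdsWithin_le_nhds, h0,
    BoundaryTriplets.isStrongResolventLimitBelow_of_tendsto hsa ?_, ?_⟩
  · have hx : Tendsto (fun x : ℝ => (x : ℂ)) (𝓝[<] 0) (𝓝 0) := by
      simpa using (Complex.continuous_ofReal.tendsto 0).mono_left nhdsWithin_le_nhds
    exact hc.comp hx
  · exact (Matrix.toEuclideanCLM (n := Fin n ⊕ Fin n) (𝕜 := ℂ)).injective
      ((map_star (Matrix.toEuclideanCLM (n := Fin n ⊕ Fin n) (𝕜 := ℂ)) _).trans hsa)
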